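/- Let $\mathbb{K}$ be $\mathbb{Z}$ with the digital (Khalimsky) topology, generated by the sets $\{n\}$ for $n$ odd and $\{n-1,n,n+1\}$ for $n$ even, and let $\mathbb{K}^2$ carry the product topology. A point of $\mathbb{K}^2$ is pure if its two coordinates have the same parity, and mixed otherwise. For $x\in\mathbb{K}^2$ let $N(x)$ be the smallest open set containing $x$, let $cl(x)$ be the closure of $\{x\}$, and let $A(x)=\{y\neq x:\{x,y\}\text{ is connected}\}$. An arc is a subset that is homeomorphic, in the subspace topology, to a nonempty finite interval $\{a,a+1,\dots,b\}$ of $\mathbb{K}$. A Jordan curve is a connected set $J\subseteq\mathbb{K}^2$ with at least four points such that $J\setminus\{x\}$ is an arc for every $x\in J$. Let $\Gamma:\mathbb{Z}^2\to\mathbb{K}^2$, $\Gamma(x,y)=(x+y,y-x)$, and for $B\subseteq\mathbb{Z}^2$ let $$\Gamma^*(B)=\Gamma(B)\cup\{x\in\mathbb{K}^2: x\text{ is mixed, and } N(x)\subseteq\Gamma(B)\cup\{x\}\text{ or }cl(x)\subseteq\Gamma(B)\cup\{x\}\}.$$ For $J\subseteq\mathbb{K}^2$ let $S_J=\{x\in\Gamma^*(\Gamma^{-1}(J)):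 x\text{ is mixed and }|A(x)\cap J|=3\}$. **Theorem.** Let $J$ be a Jordan curve in $\mathbb{K}^2$ and let $m\in\mathbb{K}^2$ be such that $S_J=\{m\}$ and $\Gamma^*(\Gamma^{-1}(J))=J\cup\{m\}$. Then $\mathbb{K}^2\setminus J$ has exactly two connected components. -/

import Mathlib

namespace DigitalTopology

/-- The underlying set of the digital line `𝕂`: the integers. -/
def DigitalLine : Type := ℤ

/-- The integer underlying a point of the digital line. -/
def DigitalLine.toInt (x : DigitalLine) : ℤ := x

/-- An integer, regarded as a point of the digital line. -/
def DigitalLine.ofInt (n : ℤ) : DigitalLine := n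

/-- The generating sets of the digital topology: `{n}` for `n` odd, `{n - 1, n, n + 1}` for
`n` even. -/
def DigitalLine.basicNhd (n : ℤ) : Set DigitalLine :=
  {x | if Odd n then x.toInt = n else (x.toInt = n - 1 ∨ x.toInt = n ∨ x.toInt = n + 1)}

/-- The digital (Khalimsky) topology. -/
instance : TopologicalSpace DigitalLine :=
  TopologicalSpace.generateFrom (Set.range DigitalLine.basicNhd)

/-- The digital plane `𝕂²`, with the product topology. -/
abbrev DigitalPlane : Type := DigitalLine × DigitalLine

/-- A point of the digital plane is pure if its coordinates are both even or both odd. -/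
def IsPure (x : DigitalPlane) : Prop :=
  (Even x.1.toInt ∧ Even x.2.toInt) ∨ (Odd x.1.toInt ∧ Odd x.2.toInt)

/-- A point of the digital plane is mixed if it is not pure. -/
def IsMixed (x : DigitalPlane) : Prop := ¬ IsPure x

/-- The adjacency `A(x)` of a point. -/
def adjacency {X : Type*} [TopologicalSpace X] (x : X) : Set X :=
  {y | y ≠ x ∧ IsConnected ({x, y} : Set X)}

/-- The (nonempty) finite interval `{a, a + 1, …, b}` of the digital line. -/
def DigitalLine.interval (a b : ℤ) : Set DigitalLine := {x | a ≤ x.toInt ∧ x.toInt ≤ b}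

/-- An arc: a subset which, with the subspace topology, is homeomorphic to a finite interval of
the digital line. -/
def IsArc {X : Type*} [TopologicalSpace X] (C : Set X) : Prop :=
  ∃ a b : ℤ, a ≤ b ∧ Nonempty (DigitalLine.interval a b ≃ₜ C)

/-- A Jordan curve: a connected subset with at least four points that becomes an arc when any
one of its points is removed. -/
def IsJordanCurve {X : Type*} [TopologicalSpace X] (J : Set X) : Prop :=
  IsConnected J ∧ 4 ≤ J.encard ∧ ∀ x ∈ J, IsArc (J \ {x})

/-- The slant map `Γ : ℤ² → 𝕂²`, `Γ(x, y) = (x + y, y - x)`. -/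
def slant (p : ℤ × ℤ) : DigitalPlane :=
  (DigitalLine.ofInt (p.1 + p.2), DigitalLine.ofInt (p.2 - p.1))

/-- The operator `Γ*`. Here `nhdsKer {x}` is the minimal open neighbourhood `N(x)` of `x` and
`closure {x}` is `cl(x)`. -/
def slantStar (A : Set (ℤ × ℤ)) : Set DigitalPlane :=
  slant '' A ∪ {x | IsMixed x ∧
    (nhdsKer {x} ⊆ slant '' A ∪ {x} ∨ closure {x} ⊆ slant '' A ∪ {x})}

/-- The set `S_J` of mixed points of `Γ*(Γ⁻¹(J))` that are adjacent to exactly three points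
of `J`. -/
def threeAdjacent (J : Set DigitalPlane) : Set DigitalPlane :=
  {m | m ∈ slantStar (slant ⁻¹' J) ∧ IsMixed m ∧ (adjacency m ∩ J).encard = 3}

end DigitalTopology

/-!
On an Alexandrov-discrete space, connectedness is connectedness of the graph that joins `x` and `y`
when `{x, y}` is connected. Removing any vertex from the graph of a Jordan curve leaves a path, so
counting edges shows that all its degrees are two; hence the curve is an induced cycle `J` in the
graph of the digital plane.

At most two components: the plane behaves like a triangulated surface, in that the neighbours of
every point form a cycle. Around a point of `J` this cycle is cut by `J` into two arcs, so a
complementary component that touches one edge of `J` touches the next one, and therefore all of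
them. It then contains one of the only two common neighbours of the ends of a fixed edge.

At least two components: off `J`, the parity of the number of times that `J` crosses a horizontal
ray starting at `p` does not change along edges, and it takes both values near a rightmost lowest
point of `J`.
-/

namespace DigitalTopology

open SimpleGraph Finset Topology

section SpecializationGraph

variable {X Y : Type*} [TopologicalSpace X] [TopologicalSpace Y]

/-- The specialization graph of a space joins two distinct points when one of them lies in the
closure of the other, that is, when they form a connected pair. On an Alexandrov-discrete space it
carries all the information about connectedness. -/
def specializationGraph (X : Type*) [TopologicalSpace X] : SimpleGraph X where
  Adj x y := x ≠ y ∧ (x ⤳ y ∨ y ⤳ x)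
  symm := ⟨fun _ _ h => ⟨h.1.symm, h.2.symm⟩⟩
  loopless := ⟨fun _ h => h.1 rfl⟩

theorem specializationGraph_adj {x y : X} :
    (specializationGraph X).Adj x y ↔ x ≠ y ∧ (x ⤳ y ∨ y ⤳ x) :=
  Iff.rfl

theorem specializationGraph_subtype (s : Set X) :
    specializationGraph s = (specializationGraph X).induce s := by
  ext x y
  simp only [specializationGraph_adj, comap_adj, Function.Embedding.subtype_apply, ne_eq,
    Subtype.ext_iff, subtype_specializes_iff]

/-- Homeomorphic spaces have isomorphic specialization graphs. -/
def specializationGraphIso (h : X ≃ₜ Y) : specializationGraph X ≃g specializationGraph Y where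
  toEquiv := h.toEquiv
  map_rel_iff' := by
    simp only [specializationGraph_adj, Homeomorph.coe_toEquiv, ne_eq, h.injective.eq_iff,
      h.isInducing.specializes_iff, implies_true]

theorem coe_connectedComponents_eq_of_reachable {x y : X}
    (h : (specializationGraph X).Reachable x y) : (x : ConnectedComponents X) = y := by
  obtain ⟨p⟩ := h
  induction p with
  | nil => rfl
  | cons hadj _ ih =>
    have hcoe {a b : X} (hab : a ⤳ b) : (a : ConnectedComponents X) = b :=
      (hab.map ConnectedComponents.continuous_coe).eq
    exact (hadj.2.elim hcoe fun h => (hcoe h).symm).trans ih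

theorem isOpen_of_forall_specializationGraph_adj [AlexandrovDiscrete X] {s : Set X}
    (hs : ∀ x y, (specializationGraph X).Adj x y → x ∈ s → y ∈ s) : IsOpen s := by
  refine isOpen_iff_forall_specializes.2 fun x y hxy hy => ?_
  by_cases hne : y = x
  · rwa [← hne]
  · exact hs y x ⟨hne, .inr hxy⟩ hy

theorem coe_connectedComponents_eq_iff_reachable [AlexandrovDiscrete X] {x y : X} :
    (x : ConnectedComponents X) = y ↔ (specializationGraph X).Reachable x y := by
  refine ⟨fun h => ?_, coe_connectedComponents_eq_of_reachable⟩
  have hclopen : IsClopen {z | (specializationGraph X).Reachable x z} :=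
    ⟨⟨isOpen_of_forall_specializationGraph_adj fun _ _ hadj hx hy =>
        hx (hy.trans hadj.symm.reachable)⟩,
      isOpen_of_forall_specializationGraph_adj fun _ _ hadj hx => hx.trans hadj.reachable⟩
  exact hclopen.connectedComponent_subset (.refl x) (ConnectedComponents.coe_eq_coe'.1 h.symm)

theorem card_connectedComponents_eq [AlexandrovDiscrete X] :
    Nat.card (ConnectedComponents X) = Nat.card (specializationGraph X).ConnectedComponent :=
  Nat.card_congr <| Quot.congr (Equiv.refl X) fun _ _ =>
    ConnectedComponents.coe_eq_coe.symm.trans coe_connectedComponents_eq_iff_reachable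

theorem specializationGraph_preconnected [AlexandrovDiscrete X] [PreconnectedSpace X] :
    (specializationGraph X).Preconnected := fun _ _ =>
  coe_connectedComponents_eq_iff_reachable.1 (Subsingleton.elim _ _)

end SpecializationGraph

namespace DigitalLine

theorem mem_basicNhd_iff {x : DigitalLine} {n : ℤ} :
    x ∈ basicNhd n ↔ x.toInt = n ∨ 2 ∣ n ∧ (x.toInt = n - 1 ∨ x.toInt = n + 1) := by
  unfold basicNhd
  rw [Set.mem_ofPred_eq, ← even_iff_two_dvd, ← Int.not_odd_iff_even]
  split_ifs with hn <;> simp only [hn, not_true_eq_false, not_false_eq_true, false_and, or_false,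
    true_and]
  tauto

theorem isOpen_basicNhd (n : ℤ) : IsOpen (basicNhd n) :=
  TopologicalSpace.isOpen_generateFrom_of_mem ⟨n, rfl⟩

theorem self_mem_basicNhd (x : DigitalLine) : x ∈ basicNhd x.toInt :=
  mem_basicNhd_iff.2 (.inl rfl)

theorem basicNhd_subset {x : DigitalLine} {n : ℤ} (hx : x ∈ basicNhd n) :
    basicNhd x.toInt ⊆ basicNhd n := by
  intro y hy
  rw [mem_basicNhd_iff] at *
  omega

theorem nhds_eq_principal (x : DigitalLine) : 𝓝 x = .principal (basicNhd x.toInt) := by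
  refine le_antisymm
    (Filter.le_principal_iff.2 ((isOpen_basicNhd _).mem_nhds (self_mem_basicNhd x))) ?_
  rw [TopologicalSpace.nhds_generateFrom]
  refine le_iInf₂ ?_
  rintro _ ⟨hx, n, rfl⟩
  exact Filter.principal_mono.2 (basicNhd_subset hx)

theorem specializes_iff_mem_basicNhd {x y : DigitalLine} : x ⤳ y ↔ x ∈ basicNhd y.toInt := by
  rw [specializes_iff_pure, nhds_eq_principal, Filter.pure_le_principal]

instance : AlexandrovDiscrete DigitalLine :=
  alexandrovDiscrete_iff_nhds.2 fun x => by
    rw [nhdsKer, nhdsSet_singleton, nhds_eq_principal, Filter.ker_principal]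

theorem specializes_iff {x y : DigitalLine} :
    x ⤳ y ↔ x.toInt = y.toInt ∨
      2 ∣ y.toInt ∧ (x.toInt = y.toInt - 1 ∨ x.toInt = y.toInt + 1) :=
  specializes_iff_mem_basicNhd.trans mem_basicNhd_iff

theorem specializationGraph_adj_iff {x y : DigitalLine} :
    (specializationGraph DigitalLine).Adj x y ↔ y.toInt = x.toInt + 1 ∨ x.toInt = y.toInt + 1 := by
  have hne : x ≠ y ↔ x.toInt ≠ y.toInt := Iff.rfl
  rw [specializationGraph_adj, hne, specializes_iff, specializes_iff]
  omega

end DigitalLine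

section Trees

variable {V : Type*}

theorem hasse_isAcyclic (α : Type*) [LinearOrder α] : (hasse α).IsAcyclic := by
  have hbridge {a b : α} (hab : a ⋖ b) : (hasse α).IsBridge s(a, b) := by
    rw [isBridge_iff]
    rintro ⟨p⟩
    obtain ⟨d, -, hfst, hsnd⟩ := p.exists_boundary_dart (Set.Iic a) le_rfl hab.lt.not_ge
    obtain ⟨hadj, hne⟩ := deleteEdges_adj.1 d.adj
    have hcov : d.fst ⋖ d.snd := (hasse_adj.1 hadj).resolve_right fun h =>
      hsnd (h.le.trans hfst)
    have hfst_eq : d.fst = a :=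
      eq_of_le_of_not_lt hfst fun h => hcov.2 h (not_le.1 hsnd)
    rw [hfst_eq] at hcov hne
    exact hne (congrArg (s(a, ·)) (hcov.unique_right hab))
  rw [isAcyclic_iff_forall_adj_isBridge]
  rintro a b (hab | hba)
  · exact hbridge hab
  · exact Sym2.eq_swap ▸ hbridge hba

theorem pathGraph_isTree (n : ℕ) : (pathGraph (n + 1)).IsTree :=
  ⟨pathGraph_connected n, hasse_isAcyclic _⟩

/-- Deleting the vertex `x` from the graph induced on `s` leaves the graph induced on `s \ {x}`. -/
def induceInduceComplSingletonIso (G : SimpleGraph V) {s : Set V} (x : s) :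
    (G.induce s).induce {x}ᶜ ≃g G.induce (s \ {x.1}) where
  toFun y := ⟨y.1.1, y.1.2, fun h => y.2 (Subtype.ext h)⟩
  invFun y := ⟨⟨y.1, y.2.1⟩, fun h => y.2.2 (congrArg Subtype.val h)⟩
  left_inv _ := rfl
  right_inv _ := rfl
  map_rel_iff' := Iff.rfl

variable [Fintype V] {H : SimpleGraph V}

/-- Deleting `x` leaves `#V - 2` edges, so all degrees equal `#E + 2 - #V`; summing them gives
`2 * #E`, and the only solution is `#E = #V`. -/
theorem degree_eq_two_of_isTree [DecidableRel H.Adj] (hV : 3 ≤ Fintype.card V)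
    (hH : ∀ x, (H.induce {x}ᶜ).IsTree) (x : V) : H.degree x = 2 := by
  classical
  have hedges (y : V) : #H.edgeFinset + 2 = Fintype.card V + H.degree y := by
    have htree := (hH y).card_edgeFinset
    rw [card_edgeFinset_induce_compl_singleton, card_edgeFinset_deleteIncidenceSet,
      Fintype.card_compl_set, Set.card_singleton] at htree
    have hle : H.degree y ≤ #H.edgeFinset := H.degree_le_card_edgeFinset y
    omega
  have hsum := H.sum_degrees_eq_twice_card_edges
  have hdeg (y : V) : H.degree y = H.degree x := by linarith [hedges x, hedges y]
  simp only [hdeg, sum_const, card_univ, smul_eq_mul] at hsum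
  obtain ⟨k, hk⟩ := Nat.exists_eq_add_of_le hV
  have hprod : (k + 1) * H.degree x = (k + 1) * 2 := by
    have := hedges x
    rw [hk] at this hsum
    linarith
  exact Nat.eq_of_mul_eq_mul_left k.succ_pos hprod

theorem cliqueFree_of_isAcyclic {m : ℕ} (hm : 3 ≤ m) (hV : m < Fintype.card V)
    (hH : ∀ x, (H.induce {x}ᶜ).IsAcyclic) : H.CliqueFree m := by
  intro t ht
  obtain ⟨x, hx⟩ : ∃ x, x ∉ t := by
    by_contra! hall
    rw [← ht.card_eq, ← card_univ, eq_univ_iff_forall.2 hall] at hV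
    exact hV.false
  have hfree := (cliqueFree_induce_iff H _ m).1 ((hH x).colorable_two.cliqueFree hm)
  exact hfree (fun y hy hyx => hx (hyx ▸ hy)) ht

end Trees

section InducedCycle

variable {V W : Type*} {G : SimpleGraph V} {G' : SimpleGraph W} {J : Set V}

/-- `J` is the vertex set of an induced cycle of `G` of length at least four: the purely
combinatorial content of a Jordan curve. Excluding triangles is how the length is bounded below. -/
structure IsInducedCycle (G : SimpleGraph V) (J : Set V) : Prop where
  finite : J.Finite
  connected : (G.induce J).Connected
  ncard_neighborSet_inter : ∀ v ∈ J, (G.neighborSet v ∩ J).ncard = 2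
  cliqueFree_three : (G.induce J).CliqueFree 3

theorem IsInducedCycle.image (hJ : IsInducedCycle G J) (φ : G ≃g G') :
    IsInducedCycle G' (φ '' J) where
  finite := hJ.finite.image φ
  connected := (φ.induce φ.injective.injOn.bijOn_image).connected_iff.1 hJ.connected
  ncard_neighborSet_inter := by
    rintro _ ⟨v, hv, rfl⟩
    rw [← hJ.ncard_neighborSet_inter v hv, ← Set.ncard_image_of_injective _ φ.injective,
      Set.image_inter φ.injective, φ.image_neighborSet]
  cliqueFree_three :=
    hJ.cliqueFree_three.comap (φ.induce φ.injective.injOn.bijOn_image).symm.isContained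

theorem degree_induce_eq_ncard {v : V} (hv : v ∈ J) [Fintype ((G.induce J).neighborSet ⟨v, hv⟩)] :
    (G.induce J).degree ⟨v, hv⟩ = (G.neighborSet v ∩ J).ncard := by
  rw [Set.inter_comm, ← Subtype.image_preimage_coe,
    Set.ncard_image_of_injective _ Subtype.val_injective, ← card_neighborSet_eq_degree,
    ← Nat.card_eq_fintype_card]
  rfl

theorem IsInducedCycle.not_adj_of_adj_of_adj {u v w : V}
    (hJ : IsInducedCycle G J) (hu : u ∈ J) (hv : v ∈ J) (hw : w ∈ J) (huv : G.Adj u v)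
    (huw : G.Adj u w) : ¬G.Adj v w := by
  classical
  intro hvw
  exact hJ.cliqueFree_three {⟨u, hu⟩, ⟨v, hv⟩, ⟨w, hw⟩}
    (is3Clique_triple_iff.2 ⟨induce_adj.2 huv, induce_adj.2 huw, induce_adj.2 hvw⟩)

theorem IsInducedCycle.even_degree (hJ : IsInducedCycle G J) (v : J)
    [Fintype ((G.induce J).neighborSet v)] :
    Even ((G.induce J).degree v) := by
  rw [degree_induce_eq_ncard v.2, hJ.ncard_neighborSet_inter v v.2]
  exact even_two

end InducedCycle

section JordanCurve

variable {X : Type*} [TopologicalSpace X] {J C : Set X}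

/-- The points of an interval of the digital line, numbered from its left end. -/
def DigitalLine.intervalEquivFin {a b : ℤ} (hab : a ≤ b) :
    interval a b ≃ Fin ((b - a).toNat + 1) where
  toFun x := ⟨(x.1.toInt - a).toNat, by
    have hx : a ≤ x.1.toInt ∧ x.1.toInt ≤ b := x.2
    omega⟩
  invFun i := ⟨ofInt (a + i), show a ≤ a + (i : ℤ) ∧ a + (i : ℤ) ≤ b by omega⟩
  left_inv x := by
    have hx : a ≤ x.1.toInt ∧ x.1.toInt ≤ b := x.2
    exact Subtype.ext (show a + ((x.1.toInt - a).toNat : ℤ) = x.1.toInt by omega)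
  right_inv i := Fin.ext (show (a + (i : ℤ) - a).toNat = i by omega)

/-- An interval of the digital line has a path as its specialization graph. -/
def DigitalLine.intervalIsoPathGraph {a b : ℤ} (hab : a ≤ b) :
    specializationGraph (interval a b) ≃g pathGraph ((b - a).toNat + 1) where
  toEquiv := intervalEquivFin hab
  map_rel_iff' {x y} := by
    have hx : a ≤ x.1.toInt ∧ x.1.toInt ≤ b := x.2
    have hy : a ≤ y.1.toInt ∧ y.1.toInt ≤ b := y.2
    rw [specializationGraph_subtype, induce_adj, specializationGraph_adj_iff, pathGraph_adj]
    simp only [intervalEquivFin, Equiv.coe_fn_mk]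
    omega

theorem IsArc.finite (hC : IsArc C) : C.Finite := by
  obtain ⟨a, b, hab, ⟨h⟩⟩ := hC
  exact Finite.of_equiv _ ((DigitalLine.intervalEquivFin hab).symm.trans h.toEquiv)

theorem IsArc.isTree (hC : IsArc C) : ((specializationGraph X).induce C).IsTree := by
  obtain ⟨a, b, hab, ⟨h⟩⟩ := hC
  rw [← specializationGraph_subtype, ← (specializationGraphIso h).isTree_iff,
    (DigitalLine.intervalIsoPathGraph hab).isTree_iff]
  exact pathGraph_isTree _

theorem IsJordanCurve.finite (hJ : IsJordanCurve J) : J.Finite := by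
  obtain ⟨x, hx⟩ := hJ.1.nonempty
  exact .of_sdiff (hJ.2.2 x hx).finite (Set.finite_singleton x)

theorem IsJordanCurve.connected (hJ : IsJordanCurve J) :
    ((specializationGraph X).induce J).Connected := by
  have := hJ.finite.to_subtype
  have := isConnected_iff_connectedSpace.1 hJ.1
  rw [← specializationGraph_subtype]
  exact ⟨specializationGraph_preconnected⟩

theorem IsJordanCurve.isTree_induce_compl_singleton (hJ : IsJordanCurve J) (x : J) :
    (((specializationGraph X).induce J).induce {x}ᶜ).IsTree :=
  (induceInduceComplSingletonIso _ x).isTree_iff.2 (hJ.2.2 x x.2).isTree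

theorem IsJordanCurve.four_le_card [Fintype J] (hJ : IsJordanCurve J) : 4 ≤ Fintype.card J := by
  have h := hJ.2.1
  rw [← Set.coe_fintypeCard] at h
  exact_mod_cast h

theorem IsJordanCurve.isInducedCycle (hJ : IsJordanCurve J) :
    IsInducedCycle (specializationGraph X) J where
  finite := hJ.finite
  connected := hJ.connected
  ncard_neighborSet_inter v hv := by
    classical
    have := hJ.finite.fintype
    rw [← degree_induce_eq_ncard hv]
    exact degree_eq_two_of_isTree (le_trans (by decide) hJ.four_le_card)
      hJ.isTree_induce_compl_singleton _
  cliqueFree_three := by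
    have := hJ.finite.fintype
    exact cliqueFree_of_isAcyclic le_rfl hJ.four_le_card fun x =>
      (hJ.isTree_induce_compl_singleton x).isAcyclic

end JordanCurve

section CyclicLinks

variable {V : Type*} {G : SimpleGraph V} {J : Set V} {v w : V}

theorem cycleGraph_induce_compl_singleton_preconnected (n : ℕ) (i : Fin (n + 2)) :
    ((cycleGraph (n + 2)).induce {i}ᶜ).Preconnected := by
  let f : pathGraph (n + 1) →g (cycleGraph (n + 2)).induce {i}ᶜ :=
    { toFun k := ⟨i + k.succ, by simp⟩
      map_rel' := by
        intro k l hkl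
        rw [induce_adj, cycleGraph_adj, add_sub_add_left_eq_sub, add_sub_add_left_eq_sub,
          ← cycleGraph_adj]
        refine pathGraph_le_cycleGraph (pathGraph_adj.2 ?_)
        simpa only [Fin.val_succ, add_left_inj] using pathGraph_adj.1 hkl }
  refine (pathGraph_preconnected _).map f fun ⟨x, hx⟩ => ?_
  obtain ⟨k, hk⟩ := Fin.exists_succ_eq.2 (sub_ne_zero.2 hx)
  exact ⟨k, Subtype.ext (show i + k.succ = x by rw [hk, add_sub_cancel])⟩

/-- In a graph with cyclic links the neighbours of every vertex form an induced cycle, as for the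
edge graph of a triangulated surface without boundary. -/
def HasCyclicLinks (G : SimpleGraph V) : Prop :=
  ∀ v, ∃ n, Nonempty (cycleGraph (n + 3) ≃g G.induce (G.neighborSet v))

namespace HasCyclicLinks

theorem ncard_commonNeighbors (hG : HasCyclicLinks G) (hvw : G.Adj v w) :
    (G.commonNeighbors v w).ncard = 2 := by
  obtain ⟨n, ⟨e⟩⟩ := hG v
  have hw : w ∈ G.neighborSet v := hvw
  have := Fintype.ofEquiv _ e.toEquiv
  have := Fintype.ofFinite ((G.induce (G.neighborSet v)).neighborSet ⟨w, hw⟩)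
  rw [commonNeighbors_symm, commonNeighbors_eq, ← degree_induce_eq_ncard hw, ← e.symm.degree_eq]
  exact cycleGraph_degree_three_le

theorem preconnected_induce_neighborSet_diff (hG : HasCyclicLinks G) (hvw : G.Adj v w) :
    (G.induce (G.neighborSet v \ {w})).Preconnected := by
  obtain ⟨n, ⟨e⟩⟩ := hG v
  obtain ⟨i, hi⟩ := e.surjective ⟨w, hvw⟩
  have hbij : Set.BijOn e {i}ᶜ {e i}ᶜ := by
    rw [← Set.image_singleton, ← Set.image_compl_eq e.bijective]
    exact e.injective.injOn.bijOn_image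
  let φ := (induceInduceComplSingletonIso G (e i)).comp (e.induce hbij)
  rw [show w = (e i).1 from (congrArg Subtype.val hi).symm]
  exact (cycleGraph_induce_compl_singleton_preconnected _ i).map φ.toEmbedding.toHom φ.surjective

/-- If `w` is the other neighbour of `u` on the curve, then `t` is the only point of the curve in
the arc `N(u) \ {w}`, so a walk in this arc from `c` to `t` must enter `t` from a point of `c`. -/
theorem exists_mem_commonNeighbors_of_adj (hG : HasCyclicLinks G) (hJ : IsInducedCycle G J)
    (c : G.ComponentCompl J) {u t y : V} (hu : u ∈ J) (ht : t ∈ J) (hut : G.Adj u t) (hy : y ∈ c)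
    (huy : G.Adj u y) : ∃ x ∈ c, x ∈ G.commonNeighbors u t := by
  have htmem : t ∈ G.neighborSet u ∩ J := ⟨hut, ht⟩
  obtain ⟨w, hwt, hpair⟩ : ∃ w, w ≠ t ∧ G.neighborSet u ∩ J = {w, t} := by
    obtain ⟨a, b, hab, hpair⟩ := Set.ncard_eq_two.1 (hJ.ncard_neighborSet_inter u hu)
    rw [hpair] at htmem ⊢
    obtain rfl | rfl := htmem
    exacts [⟨b, hab.symm, Set.pair_comm _ _⟩, ⟨a, hab, rfl⟩]
  have hw : w ∈ G.neighborSet u ∩ J := hpair ▸ Set.mem_insert w {t}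
  have hyw : y ≠ w := fun h => ComponentCompl.notMem_of_mem hy (h ▸ hw.2)
  obtain ⟨p⟩ := hG.preconnected_induce_neighborSet_diff hw.1 ⟨y, huy, hyw⟩ ⟨t, hut, hwt.symm⟩
  obtain ⟨d, -, hfst, hsnd⟩ := p.exists_boundary_dart {x | x.1 ∈ c} hy
    fun h => ComponentCompl.notMem_of_mem h ht
  have hsndJ : d.snd.1 ∈ J := by
    by_contra h
    exact hsnd (ComponentCompl.mem_of_adj _ _ hfst h d.adj)
  have hsnd_eq : d.snd.1 = t :=
    (hpair ▸ (⟨d.snd.2.1, hsndJ⟩ : d.snd.1 ∈ G.neighborSet u ∩ J) :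
      d.snd.1 ∈ ({w, t} : Set V)).resolve_left d.snd.2.2
  exact ⟨d.fst, hfst, d.fst.2.1, hsnd_eq ▸ d.adj.symm⟩

theorem exists_adj_mem_componentCompl (hG : HasCyclicLinks G) (hconn : G.Preconnected)
    (hJ : IsInducedCycle G J) (c : G.ComponentCompl J) {u : V} (hu : u ∈ J) :
    ∃ y ∈ c, G.Adj u y := by
  obtain ⟨⟨y, v⟩, hy, hv, hyv⟩ := c.exists_adj_boundary_pair hconn ⟨u, hu⟩
  obtain ⟨p⟩ := hJ.connected.preconnected ⟨v, hv⟩ ⟨u, hu⟩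
  by_contra hnot
  obtain ⟨d, -, ⟨x, hx, hfst⟩, hsnd⟩ :=
    p.exists_boundary_dart {z | ∃ y ∈ c, G.Adj z y} ⟨y, hy, hyv.symm⟩ hnot
  obtain ⟨z, hz, hz'⟩ := hG.exists_mem_commonNeighbors_of_adj hJ c d.fst.2 d.snd.2 d.adj hx hfst
  exact hsnd ⟨z, hz, hz'.2⟩

theorem card_componentCompl_le_two (hG : HasCyclicLinks G) (hconn : G.Preconnected)
    (hJ : IsInducedCycle G J) :
    Finite (G.ComponentCompl J) ∧ Nat.card (G.ComponentCompl J) ≤ 2 := by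
  obtain ⟨⟨u, hu⟩⟩ := hJ.connected.nonempty
  obtain ⟨t, hut, ht⟩ : (G.neighborSet u ∩ J).Nonempty :=
    Set.nonempty_of_ncard_ne_zero (by rw [hJ.ncard_neighborSet_inter u hu]; decide)
  have hmeet (c : G.ComponentCompl J) : ∃ x ∈ c, x ∈ G.commonNeighbors u t := by
    obtain ⟨y, hy, huy⟩ := hG.exists_adj_mem_componentCompl hconn hJ c hu
    exact hG.exists_mem_commonNeighbors_of_adj hJ c hu ht hut hy huy
  choose f hfc hf using hmeet
  have hinj : Function.Injective fun c => (⟨f c, hf c⟩ : G.commonNeighbors u t) := by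
    intro c d hcd
    have hfcd : f c = f d := congrArg Subtype.val hcd
    have hfd : f c ∈ d := hfcd ▸ hfc d
    by_contra hne
    exact (ComponentCompl.pairwise_disjoint hne).le_bot ⟨hfc c, hfd⟩
  have hcard := hG.ncard_commonNeighbors hut
  have : Finite (G.commonNeighbors u t) := Set.finite_of_ncard_ne_zero (by rw [hcard]; decide)
  refine ⟨Finite.of_injective _ hinj, ?_⟩
  rw [← hcard]
  exact Nat.card_le_card_of_injective _ hinj

end HasCyclicLinks

end CyclicLinks

section DartParity

variable {V : Type*} [Fintype V] {H : SimpleGraph V} [DecidableRel H.Adj]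

theorem even_card_filter_dart_of_symm (P : H.Dart → Prop) [DecidablePred P]
    (hP : ∀ d, P d → P d.symm) : Even #{d : H.Dart | P d} := by
  rw [← ZMod.natCast_eq_zero_iff_even, card_eq_sum_ones, Nat.cast_sum]
  refine sum_involution (fun d _ => d.symm) (fun _ _ => by decide) (fun d _ _ => d.symm_ne)
    (fun d hd => ?_) fun d _ => d.symm_symm
  exact (mem_filter_univ _).2 (hP d ((mem_filter_univ _).1 hd))

theorem even_card_filter_dart_fst (hH : ∀ v, Even (H.degree v)) (P : V → Prop)
    [DecidablePred P] : Even #{d : H.Dart | P d.fst} := by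
  classical
  rw [card_eq_sum_card_fiberwise (f := fun d : H.Dart => d.fst) (t := {v | P v})
    fun d hd => by simpa using hd]
  refine even_sum _ fun v hv => ?_
  have hfiber : {d ∈ ({d | P d.fst} : Finset H.Dart) | d.fst = v} =
      ({d | d.fst = v} : Finset _) := by
    rw [filter_filter]
    refine filter_congr fun d _ => and_iff_right_of_imp ?_
    rintro rfl
    exact (mem_filter_univ _).1 hv
  rw [hfiber, H.dart_fst_fiber_card_eq_degree]
  exact hH v

end DartParity

section KhalimskyGraph

/-- The adjacency graph of the digital plane in integer coordinates: pure points are joined to all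
eight surrounding points, mixed points only to the four that share a coordinate with them. -/
def khalimskyGraph : SimpleGraph (ℤ × ℤ) where
  Adj u v := ¬(u.1 = v.1 ∧ u.2 = v.2) ∧ (u.1 ≤ v.1 + 1 ∧ v.1 ≤ u.1 + 1) ∧
    (u.2 ≤ v.2 + 1 ∧ v.2 ≤ u.2 + 1) ∧ (2 ∣ u.1 - u.2 ∨ u.1 = v.1 ∨ u.2 = v.2)
  symm := ⟨fun _ _ => by omega⟩
  loopless := ⟨fun _ => by omega⟩

theorem khalimskyGraph_adj {u v : ℤ × ℤ} :
    khalimskyGraph.Adj u v ↔ ¬(u.1 = v.1 ∧ u.2 = v.2) ∧ (u.1 ≤ v.1 + 1 ∧ v.1 ≤ u.1 + 1) ∧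
      (u.2 ≤ v.2 + 1 ∧ v.2 ≤ u.2 + 1) ∧ (2 ∣ u.1 - u.2 ∨ u.1 = v.1 ∨ u.2 = v.2) :=
  Iff.rfl

instance : DecidableRel khalimskyGraph.Adj := fun _ _ =>
  decidable_of_iff' _ khalimskyGraph_adj

theorem khalimskyGraph_preconnected : khalimskyGraph.Preconnected := by
  have hgrid := (hasse_preconnected_of_succ ℤ).boxProd (hasse_preconnected_of_succ ℤ)
  refine hgrid.mono fun u v huv => ?_
  rw [boxProd_adj, hasse_adj, hasse_adj, Order.covBy_iff_add_one_eq, Order.covBy_iff_add_one_eq,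
    Order.covBy_iff_add_one_eq, Order.covBy_iff_add_one_eq] at huv
  rw [khalimskyGraph_adj]
  omega

/-- Translation by a pure vector, an automorphism because it preserves the parity of `x - y`. -/
def khalimskyGraphTranslate (t : ℤ × ℤ) (ht : 2 ∣ t.1 - t.2) :
    khalimskyGraph ≃g khalimskyGraph where
  toEquiv := Equiv.addRight t
  map_rel_iff' {u v} := by
    simp only [Equiv.coe_addRight, khalimskyGraph_adj, Prod.fst_add, Prod.snd_add]
    omega

/-- The neighbours of the pure point `(0, 0)`, in cyclic order. -/
def pureLink : cycleGraph 8 ↪g khalimskyGraph where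
  toFun := ![(1, 0), (1, 1), (0, 1), (-1, 1), (-1, 0), (-1, -1), (0, -1), (1, -1)]
  inj' := by decide
  map_rel_iff' := by decide

/-- The neighbours of the mixed point `(1, 0)`, in cyclic order. -/
def mixedLink : cycleGraph 4 ↪g khalimskyGraph where
  toFun := ![(2, 0), (1, 1), (0, 0), (1, -1)]
  inj' := by decide
  map_rel_iff' := by decide

theorem range_pureLink : Set.range pureLink = khalimskyGraph.neighborSet (0, 0) := by
  ext ⟨x, y⟩
  simp only [pureLink, RelEmbedding.coe_mk, Function.Embedding.coeFn_mk, Matrix.range_cons,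
    Matrix.range_empty, Set.union_empty, Set.mem_union, Set.mem_singleton_iff, Prod.mk.injEq,
    mem_neighborSet, khalimskyGraph_adj]
  omega

theorem range_mixedLink : Set.range mixedLink = khalimskyGraph.neighborSet (1, 0) := by
  ext ⟨x, y⟩
  simp only [mixedLink, RelEmbedding.coe_mk, Function.Embedding.coeFn_mk, Matrix.range_cons,
    Matrix.range_empty, Set.union_empty, Set.mem_union, Set.mem_singleton_iff, Prod.mk.injEq,
    mem_neighborSet, khalimskyGraph_adj]
  omega

theorem hasCyclicLinks_khalimskyGraph : HasCyclicLinks khalimskyGraph := by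
  have hlink {n : ℕ} (f : cycleGraph (n + 3) ↪g khalimskyGraph) {u : ℤ × ℤ}
      (hf : Set.range f = khalimskyGraph.neighborSet u) (v : ℤ × ℤ)
      (hv : 2 ∣ (v - u).1 - (v - u).2) :
      Nonempty (cycleGraph (n + 3) ≃g khalimskyGraph.induce (khalimskyGraph.neighborSet v)) := by
    let φ := khalimskyGraphTranslate (v - u) hv
    have hφ : φ '' Set.range f = khalimskyGraph.neighborSet v := by
      rw [hf, φ.image_neighborSet]
      exact congrArg _ (add_sub_cancel u v)
    exact ⟨(φ.induce (hφ ▸ φ.injective.injOn.bijOn_image)).comp f.isoInduceRange⟩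
  intro v
  by_cases hv : 2 ∣ v.1 - v.2
  · refine ⟨5, hlink pureLink range_pureLink v ?_⟩
    rwa [Prod.fst_sub, Prod.snd_sub, sub_zero, sub_zero]
  · refine ⟨1, hlink mixedLink range_mixedLink v ?_⟩
    rw [Prod.fst_sub, Prod.snd_sub]
    omega

end KhalimskyGraph

section RayCrossings

variable (J : Set (ℤ × ℤ)) [Fintype J]

/-- The number of directed edges of `J` that lead from the open horizontal ray to the right of `p`
to the row of height `k`. -/
def rayCrossings (p : ℤ × ℤ) (k : ℤ) : ℕ :=
  #{d : (khalimskyGraph.induce J).Dart |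
    (p.1 < d.fst.1.1 ∧ d.fst.1.2 = p.2) ∧ d.snd.1.2 = k}

variable {J} {p q : ℤ × ℤ}

/-- Both row changes together with the edges along the ray make up all edges that start on the ray,
an even number since every degree is even; the edges along the ray come in opposite pairs. -/
theorem even_rayCrossings_iff (hJ : ∀ v, Even ((khalimskyGraph.induce J).degree v)) (hp : p ∉ J) :
    Even (rayCrossings J p (p.2 + 1)) ↔ Even (rayCrossings J p (p.2 - 1)) := by
  have htotal := even_card_filter_dart_fst hJ fun v => p.1 < v.1.1 ∧ v.1.2 = p.2
  have hflat : Even (rayCrossings J p p.2) := by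
    refine even_card_filter_dart_of_symm _ fun d ⟨⟨_, hrow⟩, hrow'⟩ => ⟨⟨?_, hrow'⟩, hrow⟩
    have hne := Prod.ext_iff.not.1 (ne_of_mem_of_not_mem d.snd.2 hp)
    have hadj := khalimskyGraph_adj.1 (induce_adj.1 d.adj)
    change p.1 < d.snd.1.1
    omega
  rw [card_eq_sum_card_fiberwise (f := fun d => d.snd.1.2)
    (t := {p.2, p.2 + 1, p.2 - 1})] at htotal
  · simp only [filter_filter] at htotal
    rw [sum_insert, sum_pair] at htotal
    · change Even (rayCrossings J p p.2 + (rayCrossings J p _ + rayCrossings J p _)) at htotal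
      rwa [Nat.even_add, iff_true_left hflat, Nat.even_add] at htotal
    · omega
    · simp only [mem_insert, mem_singleton]
      omega
  · intro d hd
    have hadj := khalimskyGraph_adj.1 (induce_adj.1 d.adj)
    have := (mem_filter_univ _).1 hd
    simp only [coe_insert, coe_singleton, Set.mem_insert_iff, Set.mem_singleton_iff]
    omega

theorem rayCrossings_eq_of_adj_of_snd_eq (hp : p ∉ J) (hq : q ∉ J) (hpq : khalimskyGraph.Adj p q)
    (hrow : p.2 = q.2) (k : ℤ) : rayCrossings J p k = rayCrossings J q k := by
  have hpq := khalimskyGraph_adj.1 hpq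
  refine congrArg card (filter_congr fun d _ => ?_)
  have hfp := Prod.ext_iff.not.1 (ne_of_mem_of_not_mem d.fst.2 hp)
  have hfq := Prod.ext_iff.not.1 (ne_of_mem_of_not_mem d.fst.2 hq)
  omega

/-- Reversing the edges matches the upward crossings of the lower ray with the downward crossings
of the upper one. -/
theorem rayCrossings_eq_of_adj_of_snd_eq_add_one (hp : p ∉ J) (hq : q ∉ J)
    (hpq : khalimskyGraph.Adj p q) (hrow : q.2 = p.2 + 1) :
    rayCrossings J p (p.2 + 1) = rayCrossings J q (q.2 - 1) := by
  have hpq := khalimskyGraph_adj.1 hpq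
  refine card_equiv Dart.symm_involutive.toPerm fun d => ?_
  rw [mem_filter_univ, mem_filter_univ]
  change _ ↔ (q.1 < d.snd.1.1 ∧ d.snd.1.2 = q.2) ∧ d.fst.1.2 = q.2 - 1
  have hfst := Prod.ext_iff.not.1 (ne_of_mem_of_not_mem d.fst.2 hp)
  have hsnd := Prod.ext_iff.not.1 (ne_of_mem_of_not_mem d.snd.2 hq)
  have hadj := khalimskyGraph_adj.1 (induce_adj.1 d.adj)
  omega

theorem even_rayCrossings_iff_of_adj (hJ : ∀ v, Even ((khalimskyGraph.induce J).degree v))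
    (hp : p ∉ J) (hq : q ∉ J) (hpq : khalimskyGraph.Adj p q) :
    Even (rayCrossings J p (p.2 + 1)) ↔ Even (rayCrossings J q (q.2 + 1)) := by
  obtain hrow | hrow | hrow : p.2 = q.2 ∨ q.2 = p.2 + 1 ∨ p.2 = q.2 + 1 := by
    have := khalimskyGraph_adj.1 hpq
    omega
  · rw [rayCrossings_eq_of_adj_of_snd_eq hp hq hpq hrow, hrow]
  · rw [rayCrossings_eq_of_adj_of_snd_eq_add_one hp hq hpq hrow, even_rayCrossings_iff hJ hq]
  · rw [even_rayCrossings_iff hJ hp,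
      ← rayCrossings_eq_of_adj_of_snd_eq_add_one hq hp hpq.symm hrow]

theorem even_rayCrossings_iff_of_reachable (hJ : ∀ v, Even ((khalimskyGraph.induce J).degree v))
    {p q : ↥Jᶜ} (hpq : (khalimskyGraph.induce Jᶜ).Reachable p q) :
    Even (rayCrossings J p (p.1.2 + 1)) ↔ Even (rayCrossings J q (q.1.2 + 1)) := by
  obtain ⟨w⟩ := hpq
  induction w with
  | nil => rfl
  | @cons u v _ hadj _ ih =>
    exact (even_rayCrossings_iff_of_adj hJ u.2 v.2 hadj).trans ih

end RayCrossings

section Separation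

variable {J : Set (ℤ × ℤ)}

/-- The two neighbours on the curve of the rightmost point `s` of its lowest row are not adjacent to
each other; below and to the right of `s` being forbidden, this forces `s` to be pure. -/
theorem IsInducedCycle.exists_lowest_edge (hJ : IsInducedCycle khalimskyGraph J) :
    ∃ s ∈ J, ∃ r ∈ J, (∀ z ∈ J, s.2 < z.2 ∨ s.2 = z.2 ∧ z.1 ≤ s.1) ∧ 2 ∣ s.1 - s.2 ∧
      khalimskyGraph.Adj s r ∧ r.2 = s.2 + 1 ∧ s.1 ≤ r.1 := by
  obtain ⟨⟨u, hu⟩⟩ := hJ.connected.nonempty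
  obtain ⟨s, hs, hmin⟩ := Set.exists_min_image J (fun z => toLex (z.2, -z.1)) hJ.finite ⟨u, hu⟩
  replace hmin : ∀ z ∈ J, s.2 < z.2 ∨ s.2 = z.2 ∧ z.1 ≤ s.1 := fun z hz => by
    simpa only [Prod.Lex.toLex_le_toLex, neg_le_neg_iff] using hmin z hz
  obtain ⟨a, b, hab, hpair⟩ := Set.ncard_eq_two.1 (hJ.ncard_neighborSet_inter s hs)
  obtain ⟨hsa, ha⟩ : a ∈ khalimskyGraph.neighborSet s ∩ J := hpair ▸ Set.mem_insert a {b}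
  obtain ⟨hsb, hb⟩ : b ∈ khalimskyGraph.neighborSet s ∩ J := hpair ▸ Set.mem_insert_of_mem a rfl
  have hab' := hJ.not_adj_of_adj_of_adj hs ha hb hsa hsb
  rw [← Prod.mk.eta (p := a), ← Prod.mk.eta (p := b), Ne, Prod.mk.injEq] at hab
  have hsa' := khalimskyGraph_adj.1 hsa
  have hsb' := khalimskyGraph_adj.1 hsb
  rw [khalimskyGraph_adj] at hab'
  have hmina := hmin a ha
  have hminb := hmin b hb
  obtain ⟨hpure, h | h⟩ : 2 ∣ s.1 - s.2 ∧
      (a.2 = s.2 + 1 ∧ s.1 ≤ a.1 ∨ b.2 = s.2 + 1 ∧ s.1 ≤ b.1) := by omega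
  · exact ⟨s, hs, a, ha, hmin, hpure, hsa, h⟩
  · exact ⟨s, hs, b, hb, hmin, hpure, hsb, h⟩

/-- In terms of the edge from `s` to `r` provided by `exists_lowest_edge`, `p` lies just to the
right of `s`, outside the curve, and `q` just to the left of `r`, inside. The only edge that leads
down from the ray at `q` is the one from `r` to `s`. -/
theorem IsInducedCycle.exists_rayCrossings_eq [Fintype J] (hJ : IsInducedCycle khalimskyGraph J) :
    ∃ p ∉ J, ∃ q ∉ J, rayCrossings J p (p.2 + 1) = 0 ∧ rayCrossings J q (q.2 - 1) = 1 := by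
  obtain ⟨s, hs, r, hr, hmin, hpure, hsr, hrow, hle⟩ := hJ.exists_lowest_edge
  have hsr' := khalimskyGraph_adj.1 hsr
  have hout : (s.1 + 1, s.2) ∉ J := fun h => by have := hmin _ h; omega
  have hnotMem {z : ℤ × ℤ} (hsz : khalimskyGraph.Adj s z) (hrz : khalimskyGraph.Adj r z) :
      z ∉ J := fun hz => hJ.not_adj_of_adj_of_adj hs hr hz hsr hsz hrz
  have hin : (r.1 - 1, r.2) ∉ J := by
    apply hnotMem <;> rw [khalimskyGraph_adj] <;> dsimp only <;> omega
  have hcorner (h : r.1 = s.1) : (r.1 + 1, r.2) ∉ J := by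
    apply hnotMem <;> rw [khalimskyGraph_adj] <;> dsimp only <;> omega
  have hup : rayCrossings J (s.1 + 1, s.2) (s.2 + 1) = 0 := by
    refine card_eq_zero.2 (filter_eq_empty_iff.2 fun d _ h => ?_)
    have := hmin _ d.fst.2
    omega
  have hdown : rayCrossings J (r.1 - 1, r.2) (r.2 - 1) = 1 := by
    refine card_eq_one.2 ⟨⟨(⟨r, hr⟩, ⟨s, hs⟩), hsr.symm⟩, ?_⟩
    ext d
    rw [mem_filter_univ, mem_singleton, Dart.ext_iff, Prod.ext_iff, Subtype.ext_iff,
      Subtype.ext_iff, Prod.ext_iff, Prod.ext_iff]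
    have hadj := khalimskyGraph_adj.1 (induce_adj.1 d.adj)
    have hsnd := hmin _ d.snd.2
    have hfst (h : r.1 = s.1) := Prod.ext_iff.not.1 (ne_of_mem_of_not_mem d.fst.2 (hcorner h))
    change _ ↔ (d.fst.1.1 = r.1 ∧ d.fst.1.2 = r.2) ∧ d.snd.1.1 = s.1 ∧ d.snd.1.2 = s.2
    omega
  exact ⟨_, hout, _, hin, hup, hdown⟩

theorem IsInducedCycle.nontrivial_componentCompl (hJ : IsInducedCycle khalimskyGraph J) :
    Nontrivial (khalimskyGraph.ComponentCompl J) := by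
  have := hJ.finite.fintype
  have heven (v : J) : Even ((khalimskyGraph.induce J).degree v) := hJ.even_degree v
  obtain ⟨p, hp, q, hq, hup, hdown⟩ := hJ.exists_rayCrossings_eq
  refine ⟨khalimskyGraph.componentComplMk hp, khalimskyGraph.componentComplMk hq, fun h => ?_⟩
  have hparity := even_rayCrossings_iff_of_reachable heven (ConnectedComponent.exact h)
  rw [even_rayCrossings_iff heven hq, hup, hdown] at hparity
  exact absurd hparity (by decide)

theorem card_componentCompl_khalimskyGraph (hJ : IsInducedCycle khalimskyGraph J) :
    Nat.card (khalimskyGraph.ComponentCompl J) = 2 := by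
  obtain ⟨_, hle⟩ :=
    hasCyclicLinks_khalimskyGraph.card_componentCompl_le_two khalimskyGraph_preconnected hJ
  have := hJ.nontrivial_componentCompl
  exact le_antisymm hle Finite.one_lt_card

end Separation

/-- Integer coordinates on the digital plane. -/
def specializationGraphIsoKhalimskyGraph : specializationGraph DigitalPlane ≃g khalimskyGraph where
  toFun x := (x.1.toInt, x.2.toInt)
  invFun p := (DigitalLine.ofInt p.1, DigitalLine.ofInt p.2)
  left_inv _ := rfl
  right_inv _ := rfl
  map_rel_iff' {x y} := by
    have hne : x ≠ y ↔ ¬(x.1.toInt = y.1.toInt ∧ x.2.toInt = y.2.toInt) := Prod.ext_iff.not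
    rw [specializationGraph_adj, hne, ← Prod.mk.eta (p := x), ← Prod.mk.eta (p := y),
      specializes_prod, specializes_prod]
    change khalimskyGraph.Adj (x.1.toInt, x.2.toInt) (y.1.toInt, y.2.toInt) ↔ _
    simp only [DigitalLine.specializes_iff, khalimskyGraph_adj]
    omega

end DigitalTopology

theorem mainTheorem7_general (J : Set DigitalTopology.DigitalPlane)
    (hJ : DigitalTopology.IsJordanCurve J) : Nat.card (ConnectedComponents ↥(Jᶜ)) = 2 := by
  let φ := DigitalTopology.specializationGraphIsoKhalimskyGraph
  have hcompl : Set.BijOn φ Jᶜ (φ '' J)ᶜ :=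
    Set.image_compl_eq φ.bijective ▸ φ.injective.injOn.bijOn_image
  rw [DigitalTopology.card_connectedComponents_eq, DigitalTopology.specializationGraph_subtype,
    Nat.card_congr (φ.induce hcompl).connectedComponentEquiv]
  exact DigitalTopology.card_componentCompl_khalimskyGraph (hJ.isInducedCycle.image φ)

theorem mainTheorem7 (J : Set DigitalTopology.DigitalPlane) (m : DigitalTopology.DigitalPlane)
    (hJ : DigitalTopology.IsJordanCurve J)
    (hS : DigitalTopology.threeAdjacent J = {m})
    (hstar : DigitalTopology.slantStar (DigitalTopology.slant ⁻¹' J) = J ∪ {m}) :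
    Nat.card (ConnectedComponents ↥(Jᶜ)) = 2 :=
  mainTheorem7_general J hJ
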